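/- Let $q,A,B,C,z\in\mathbb{C}$ with $|q|<1$ and $|z|<1$. Write $(a;q)_n=\prod_{i=0}^{n-1}(1-aq^i)$, $(a_1,\dots,a_m;q)_n=(a_1;q)_n\cdots(a_m;q)_n$, and $${}_{r+1}\phi_r\left[\begin{matrix}a_1,\dots,a_{r+1}\\ b_1,\dots,b_r\end{matrix};q,x\right]=\sum_{k=0}^\infty\frac{(a_1,\dots,a_{r+1};q)_k}{(q,b_1,\dots,b_r;q)_k}x^k .$$ Assume that $A,B,C\neq0$, that $Cq^m\neq1$ and $ABzq^m/C\neq1$ for all integers $m\ge0$ (no denominator vanishes), and that either $|ABz/C|<1$, or $(C/A)q^m=1$ or $(C/B)q^m=1$ for some integer $m\ge0$ (the inner series below converge or terminate). Then all the series below converge absolutely and $${}_{2}\phi_{1}\left[\begin{matrix}A,B\\ C\end{matrix};q,z\right]=\sum_{n=0}^{\infty}\frac{(ABq/C,ABz/C;q)_n}{(q,z;q)_n}\,z^nq^{n(n-1)}\left(1-\frac{ABzq^{2n}}{C}\right){}_{4}\phi_{3}\left[\begin{matrix}ABzq^n/C,\ ABzq^{2n+1}/C,\ C/A,\ C/B\\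 C,\ zq^n,\ ABzq^{2n}/C\end{matrix};q,\frac{ABzq^n}{C}\right].$$ -/

import Mathlib

/-- The `q`-shifted factorial `(a; q)_n = (1 - a)(1 - a q) ⋯ (1 - a q^(n-1))`. -/
noncomputable def qPoch (a q : ℂ) (n : ℕ) : ℂ :=
  ∏ i ∈ Finset.range n, (1 - a * q ^ i)

/-- The `n`-th term of the basic hypergeometric series `_{r+1}φ_r` with numerator parameters `a`,
denominator parameters `b`, base `q` and argument `z`. -/
noncomputable def qHypTerm {r : ℕ} (a : Fin (r + 1) → ℂ) (b : Fin r → ℂ) (q z : ℂ) (n : ℕ) : ℂ :=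
  (∏ i, qPoch (a i) q n) / (qPoch q q n * ∏ j, qPoch (b j) q n) * z ^ n

/-- The basic hypergeometric series `_{r+1}φ_r`. -/
noncomputable def qHyp {r : ℕ} (a : Fin (r + 1) → ℂ) (b : Fin r → ℂ) (q z : ℂ) : ℂ :=
  ∑' n : ℕ, qHypTerm a b q z n

/-!
Put `l = A * B / C`, so that `A * B * z / C = l * z`. Multiplying out the inner series, the
shifted factorials with arguments depending on `n` combine, and the `(n, k)` term of the
right-hand side becomes

  `c_k * (l q; q)_n / (q; q)_n * (l z; q)_(n+k) / (z; q)_(n+k) * (1 - l z q^(2n+k))`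
    `* z^n q^(n(n-1)+nk)`,

where `c_k` is the `k`-th term of `₂φ₁(C/A, C/B; C; q, l z)` (`coeff_mul_qHypTerm_four_three`).
The double series converges absolutely (`summable_double`), so it may be summed over `n` first.
For fixed `k` the sum over `n` is a limiting case of the very-well-poised `₆φ₅` sum, with value
`c_k * (l z; q)_∞ / (z; q)_∞` (`hasSum_veryWellPoised`). Hence the right-hand side equals
`(l z; q)_∞ / (z; q)_∞ * ₂φ₁(C/A, C/B; C; q, l z)`, which is `₂φ₁(A, B; C; q, z)` by the Euler
transformation (`hasSum_qEuler`).

The Euler transformation is the Cauchy product of `₂φ₁(C/A, C/B; C; q, l z)` with the `q`-binomial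
series (`hasSum_qBinomial`); equality of coefficients is the `q`-Pfaff–Saalschütz sum
(`qSaalschutz`). Since only absolute convergence of the factors is used, the case `‖l * z‖ < 1` and
the terminating case are treated alike. The `q`-binomial and the very-well-poised sum are both
obtained from `hasSum_of_telescoping`: replacing `z` by `z * q` changes the terms by a telescoping
difference, and in the limit `z * q ^ m → 0` only the term `n = 0` remains.

Infinite products `(l z; q)_∞ / (z; q)_∞` appear as limits of `qRatio (l * z) z q`.
-/

open Filter Topology

/-! ### Shifted factorials -/

theorem qPoch_zero (a q : ℂ) : qPoch a q 0 = 1 := by simp [qPoch]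

theorem qPoch_succ (a q : ℂ) (n : ℕ) : qPoch a q (n + 1) = qPoch a q n * (1 - a * q ^ n) := by
  simp [qPoch, Finset.prod_range_succ]

theorem qPoch_add (a q : ℂ) (m n : ℕ) :
    qPoch a q (m + n) = qPoch a q m * qPoch (a * q ^ m) q n := by
  simp only [qPoch, Finset.prod_range_add, pow_add, mul_assoc]

theorem qPoch_mul_q (a q : ℂ) (n : ℕ) :
    qPoch (a * q) q n * (1 - a) = qPoch a q n * (1 - a * q ^ n) := by
  have h := qPoch_add a q 1 n
  rw [add_comm, qPoch_succ] at h
  simp [qPoch] at h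
  simp only [qPoch]
  linear_combination -h

theorem qPoch_ne_zero {a q : ℂ} (h : ∀ m : ℕ, a * q ^ m ≠ 1) (n : ℕ) : qPoch a q n ≠ 0 :=
  Finset.prod_ne_zero_iff.2 fun i _ => sub_ne_zero.2 (h i).symm

theorem qPoch_eq_zero {a q : ℂ} {m n : ℕ} (h : a * q ^ m = 1) (hmn : m < n) : qPoch a q n = 0 :=
  Finset.prod_eq_zero (Finset.mem_range.2 hmn) (by rw [h, sub_self])

theorem mul_pow_ne_one {a q : ℂ} (ha : ‖a‖ < 1) (hq : ‖q‖ < 1) (m : ℕ) : a * q ^ m ≠ 1 := by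
  intro h
  have h' : ‖a‖ * ‖q‖ ^ m = 1 := by rw [← norm_pow, ← norm_mul, h, norm_one]
  have := mul_le_of_le_one_right (norm_nonneg a) (pow_le_one₀ (n := m) (norm_nonneg q) hq.le)
  linarith

theorem summable_norm_neg_mul_pow (a : ℂ) {q : ℂ} (hq : ‖q‖ < 1) :
    Summable fun i : ℕ => ‖-(a * q ^ i)‖ := by
  simpa [norm_mul, norm_pow] using (summable_geometric_of_lt_one (norm_nonneg q) hq).mul_left ‖a‖

theorem tendsto_qPoch (a : ℂ) {q : ℂ} (hq : ‖q‖ < 1) :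
    Tendsto (qPoch a q) atTop (𝓝 (∏' i : ℕ, (1 + -(a * q ^ i)))) := by
  have h := (multipliable_one_add_of_summable
    (summable_norm_neg_mul_pow a hq)).tendsto_prod_tprod_nat
  simp only [← sub_eq_add_neg] at h ⊢
  exact h

/-- The quotient `(a; q)_n / (b; q)_n` of shifted factorials. -/
noncomputable def qRatio (a b q : ℂ) (n : ℕ) : ℂ := qPoch a q n / qPoch b q n

theorem qRatio_zero (a b q : ℂ) : qRatio a b q 0 = 1 := by simp [qRatio, qPoch_zero]

theorem qRatio_succ (a b q : ℂ) (n : ℕ) :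
    qRatio a b q (n + 1) = qRatio a b q n * ((1 - a * q ^ n) / (1 - b * q ^ n)) := by
  rw [qRatio, qRatio, qPoch_succ, qPoch_succ, mul_div_mul_comm]

theorem qRatio_add (a b q : ℂ) (m n : ℕ) :
    qRatio a b q (m + n) = qRatio a b q m * qRatio (a * q ^ m) (b * q ^ m) q n := by
  rw [qRatio, qRatio, qRatio, qPoch_add, qPoch_add, mul_div_mul_comm]

theorem exists_tendsto_qRatio (a : ℂ) {b q : ℂ} (hq : ‖q‖ < 1) (hb : ∀ m : ℕ, b * q ^ m ≠ 1) :
    ∃ L, Tendsto (qRatio a b q) atTop (𝓝 L) := by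
  refine ⟨_, (tendsto_qPoch a hq).div (tendsto_qPoch b hq) ?_⟩
  refine tprod_one_add_ne_zero_of_summable (fun i => ?_) (summable_norm_neg_mul_pow b hq)
  rw [← sub_eq_add_neg]
  exact sub_ne_zero.2 (hb i).symm

theorem exists_norm_qRatio_le (a : ℂ) {b q : ℂ} (hq : ‖q‖ < 1) (hb : ∀ m : ℕ, b * q ^ m ≠ 1) :
    ∃ M, 0 ≤ M ∧ ∀ n, ‖qRatio a b q n‖ ≤ M := by
  obtain ⟨L, hL⟩ := exists_tendsto_qRatio a hq hb
  obtain ⟨M, hM⟩ := hL.norm.bddAbove_range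
  have h : ∀ n, ‖qRatio a b q n‖ ≤ M := fun n => hM ⟨n, rfl⟩
  exact ⟨M, (norm_nonneg _).trans (h 0), h⟩

theorem norm_one_sub_mul_pow_le (a : ℂ) {q : ℂ} (hq : ‖q‖ < 1) (n : ℕ) :
    ‖1 - a * q ^ n‖ ≤ 1 + ‖a‖ := by
  refine (norm_sub_le _ _).trans ?_
  rw [norm_one, norm_mul, norm_pow]
  have := mul_le_of_le_one_right (norm_nonneg a) (pow_le_one₀ (n := n) (norm_nonneg q) hq.le)
  linarith

theorem norm_pow_le_one {q : ℂ} (hq : ‖q‖ < 1) (n : ℕ) : ‖q ^ n‖ ≤ 1 := by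
  rw [norm_pow]
  exact pow_le_one₀ (norm_nonneg q) hq.le

theorem norm_one_sub_pow_le {q : ℂ} (hq : ‖q‖ < 1) (n : ℕ) : ‖1 - q ^ n‖ ≤ 2 := by
  have := norm_one_sub_mul_pow_le 1 hq n
  rw [one_mul, norm_one] at this
  linarith

/-! ### Summation by telescoping in a parameter -/

/-- If a dominated family of series satisfies `t m n - t (m + 1) n = u m n - u m (n + 1)` with
vanishing boundary terms, its sum does not depend on `m`; letting `m → ∞` evaluates it when only
the term `n = 0` survives in the limit. -/
theorem hasSum_of_telescoping {t u : ℕ → ℕ → ℂ} {bound : ℕ → ℝ} {L : ℂ}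
    (hbound : Summable bound) (ht : ∀ m n, ‖t m n‖ ≤ bound n)
    (hu : ∀ m, Tendsto (u m) atTop (𝓝 0)) (hu0 : ∀ m, u m 0 = 0)
    (h : ∀ m n, t m n - t (m + 1) n = u m n - u m (n + 1))
    (ht0 : Tendsto (fun m => t m 0) atTop (𝓝 L))
    (htn : ∀ n, Tendsto (fun m => t m (n + 1)) atTop (𝓝 0)) (m : ℕ) :
    HasSum (t m) L := by
  have hs : ∀ m, Summable (t m) := fun m => hbound.of_norm_bounded (ht m)
  have step : ∀ m, ∑' n, t (m + 1) n = ∑' n, t m n := by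
    intro m
    have h1 := ((hs m).hasSum.sub (hs (m + 1)).hasSum).tendsto_sum_nat
    simp only [h, Finset.sum_range_sub'] at h1
    have h2 : Tendsto (fun n => u m 0 - u m n) atTop (𝓝 0) := by
      simpa [hu0 m] using (hu m).neg
    exact (sub_eq_zero.1 (tendsto_nhds_unique h1 h2)).symm
  have const : ∀ m, ∑' n, t m n = ∑' n, t 0 n := by
    intro m
    induction m with
    | zero => rfl
    | succ m ih => rw [step, ih]
  have hlim : Tendsto (fun m => ∑' n, t m n) atTop (𝓝 (∑' n, if n = 0 then L else 0)) := by
    refine tendsto_tsum_of_dominated_convergence hbound (fun n => ?_) (Eventually.of_forall ht)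
    cases n with
    | zero => simpa using ht0
    | succ n => simpa using htn n
  rw [tsum_ite_eq] at hlim
  have hL : ∑' n, t m n = L := by
    refine tendsto_nhds_unique (tendsto_const_nhds.congr fun j => ?_) hlim
    rw [const m, const j]
  exact hL ▸ (hs m).hasSum

theorem tendsto_pow_succ_mul {q : ℂ} (hq : ‖q‖ < 1) (n : ℕ) :
    Tendsto (fun m : ℕ => q ^ ((n + 1) * m)) atTop (𝓝 0) := by
  simp only [pow_mul]
  refine tendsto_pow_atTop_nhds_zero_of_norm_lt_one ?_
  rw [norm_pow]
  exact pow_lt_one₀ (norm_nonneg q) hq n.succ_ne_zero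

/-- The `q`-binomial theorem, with the quotient of infinite products written as a limit. -/
theorem hasSum_qBinomial {l q z L : ℂ} (hq : ‖q‖ < 1) (hz : ‖z‖ < 1)
    (hL : Tendsto (qRatio (l * z) z q) atTop (𝓝 L)) :
    HasSum (fun n => qRatio l q q n * z ^ n) L := by
  obtain ⟨M, hM0, hM⟩ := exists_norm_qRatio_le l hq (mul_pow_ne_one hq hq)
  obtain ⟨N, hN0, hN⟩ := exists_norm_qRatio_le (l * z) hq (mul_pow_ne_one hz hq)
  have hgeo := summable_geometric_of_lt_one (norm_nonneg z) hz
  have hzn : ∀ m, 1 - z * q ^ m ≠ 0 := fun m => sub_ne_zero.2 (mul_pow_ne_one hz hq m).symm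
  have hqn : ∀ n, 1 - q * q ^ n ≠ 0 := fun n => sub_ne_zero.2 (mul_pow_ne_one hq hq n).symm
  have key := hasSum_of_telescoping (L := L) (bound := fun n => N * M * ‖z‖ ^ n)
    (t := fun m n => qRatio (l * z) z q m * qRatio l q q n * (z ^ n * q ^ (n * m)))
    -- the certificate of `E(z) (1 - z) = (1 - l * z) E(q * z)` for the sum `E` of the series
    (u := fun m n => qRatio (l * z) z q m / (1 - z * q ^ m) * (qRatio l q q n * (1 - q ^ n) *
      (z ^ n * q ^ (n * m)))) (hgeo.mul_left _) ?_ ?_ ?_ ?_ ?_ ?_ 0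
  · simpa [qRatio_zero] using key
  · intro m n
    rw [norm_mul, norm_mul, norm_mul, norm_pow z]
    exact mul_le_mul (mul_le_mul (hN m) (hM n) (norm_nonneg _) hN0)
      (mul_le_of_le_one_right (by positivity) (norm_pow_le_one hq _)) (by positivity)
      (by positivity)
  · intro m
    rw [← mul_zero (qRatio (l * z) z q m / (1 - z * q ^ m))]
    refine Tendsto.const_mul _ ?_
    refine ((hgeo.mul_left (M * 2)).of_norm_bounded fun n => ?_).tendsto_atTop_zero
    rw [norm_mul, norm_mul, norm_mul, norm_pow z]
    exact mul_le_mul (mul_le_mul (hM n) (norm_one_sub_pow_le hq n) (norm_nonneg _) hM0)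
      (mul_le_of_le_one_right (by positivity) (norm_pow_le_one hq _)) (by positivity)
      (by positivity)
  · intro m
    simp
  · intro m n
    have h1 := hzn m
    have h2 := hqn n
    simp only [qRatio_succ]
    rw [show (n + 1) * m = n * m + m by ring, show n * (m + 1) = n * m + n by ring]
    simp only [pow_add, pow_one]
    generalize q ^ n = x at *
    generalize q ^ m = y at *
    -- the order of factors in which `field_simp` meets this denominator
    have h2' : 1 - x * q ≠ 0 := by rwa [mul_comm]
    field_simp
    ring
  · simpa [qRatio_zero] using hL
  · intro n
    have h := ((hL.mul_const (qRatio l q q (n + 1))).mul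
      ((tendsto_pow_succ_mul hq n).const_mul (z ^ (n + 1))))
    simpa using h

/-- The limiting case of the very-well-poised `₆φ₅` sum in which two parameters tend to infinity,
for the argument `z * q ^ m`. Each term carries the factor `(l * z; q)_m / (z; q)_m`, which makes the sum
independent of `m`; the limit `m → ∞` then evaluates it. -/
theorem hasSum_veryWellPoised {l q z L : ℂ} (hq : ‖q‖ < 1) (hz : ‖z‖ < 1)
    (hL : Tendsto (qRatio (l * z) z q) atTop (𝓝 L)) (m : ℕ) :
    HasSum (fun n => qRatio (l * q) q q n * qRatio (l * z) z q (n + m) *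
      (1 - l * z * q ^ (2 * n + m)) * (z ^ n * q ^ (n * (n - 1) + n * m))) L := by
  obtain ⟨M, hM0, hM⟩ := exists_norm_qRatio_le (l * q) hq (mul_pow_ne_one hq hq)
  obtain ⟨N, hN0, hN⟩ := exists_norm_qRatio_le (l * z) hq (mul_pow_ne_one hz hq)
  have hgeo := summable_geometric_of_lt_one (norm_nonneg z) hz
  have hzn : ∀ m, 1 - z * q ^ m ≠ 0 := fun m => sub_ne_zero.2 (mul_pow_ne_one hz hq m).symm
  have hqn : ∀ n, 1 - q * q ^ n ≠ 0 := fun n => sub_ne_zero.2 (mul_pow_ne_one hq hq n).symm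
  refine hasSum_of_telescoping (L := L) (bound := fun n => M * N * (1 + ‖l * z‖) * ‖z‖ ^ n)
    (t := fun m n => qRatio (l * q) q q n * qRatio (l * z) z q (n + m) *
      (1 - l * z * q ^ (2 * n + m)) * (z ^ n * q ^ (n * (n - 1) + n * m)))
    -- the certificate relating the series for `z * q ^ m` and `z * q ^ (m + 1)`
    (u := fun m n => qRatio (l * q) q q n * qRatio (l * z) z q (n + m) * (1 - q ^ n) *
      (z ^ n * q ^ (n * (n - 1) + n * m))) (hgeo.mul_left _) ?_ ?_ ?_ ?_ ?_ ?_ m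
  · intro m n
    rw [norm_mul, norm_mul, norm_mul, norm_mul (z ^ n), norm_pow z]
    exact mul_le_mul (mul_le_mul (mul_le_mul (hM n) (hN _) (norm_nonneg _) hM0)
      (norm_one_sub_mul_pow_le _ hq _) (norm_nonneg _) (by positivity))
      (mul_le_of_le_one_right (by positivity) (norm_pow_le_one hq _)) (by positivity)
      (by positivity)
  · intro m
    refine ((hgeo.mul_left (M * N * 2)).of_norm_bounded
      fun n => ?_).tendsto_atTop_zero
    rw [norm_mul, norm_mul, norm_mul, norm_mul (z ^ n), norm_pow z]
    exact mul_le_mul (mul_le_mul (mul_le_mul (hM n) (hN _) (norm_nonneg _) hM0)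
      (norm_one_sub_pow_le hq n) (norm_nonneg _) (by positivity))
      (mul_le_of_le_one_right (by positivity) (norm_pow_le_one hq _)) (by positivity)
      (by positivity)
  · intro m
    simp
  · intro m n
    have h1 := hzn (n + m)
    have h2 := hqn n
    have h3 : (n + 1) * (n + 1 - 1) = n * (n - 1) + (n + n) := by
      cases n with
      | zero => rfl
      | succ n => simp only [Nat.add_sub_cancel]; ring
    rw [h3, show n + 1 + m = n + m + 1 by ring, show n + (m + 1) = n + m + 1 by ring,
      show (n + 1) * m = n * m + m by ring, show n * (m + 1) = n * m + n by ring]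
    simp only [qRatio_succ]
    simp only [two_mul, pow_add, pow_one] at *
    generalize q ^ n = x at *
    generalize q ^ m = y at *
    rw [← mul_assoc] at h1
    field_simp
    ring
  · have h := hL.mul (((tendsto_pow_atTop_nhds_zero_of_norm_lt_one hq).const_mul
      (l * z)).const_sub 1)
    simpa [qRatio_zero] using h
  · intro n
    have h := (((hL.comp (tendsto_add_atTop_nat (n + 1))).const_mul
      (qRatio (l * q) q q (n + 1))).mul
      (((tendsto_pow_atTop_nhds_zero_of_norm_lt_one hq).const_mul
      (l * z * q ^ (2 * (n + 1)))).const_sub 1)).mul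
      ((tendsto_pow_succ_mul hq n).const_mul (z ^ (n + 1) * q ^ ((n + 1) * n)))
    simp only [mul_zero] at h
    refine h.congr fun m => ?_
    simp only [Function.comp_apply, pow_add, Nat.add_sub_cancel, add_comm m (n + 1)]
    ring

/-! ### The Euler transformation -/

/-- The `q`-Pfaff–Saalschütz sum, written as a convolution so that it equates the coefficients
of `z ^ n` in the two sides of the Euler transformation. -/
theorem qSaalschutz {a b l q : ℂ} (hq : ‖q‖ < 1) (hC : ∀ m : ℕ, a * b * l * q ^ m ≠ 1) (n : ℕ) :
    ∑ k ∈ Finset.range (n + 1), qRatio a q q k * qRatio b (a * b * l) q k * l ^ k *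
      qRatio l q q (n - k) = qRatio (a * l) q q n * qRatio (b * l) (a * b * l) q n := by
  have hqn : ∀ n, 1 - q * q ^ n ≠ 0 := fun n => sub_ne_zero.2 (mul_pow_ne_one hq hq n).symm
  have hCn : ∀ n, 1 - a * b * l * q ^ n ≠ 0 := fun n => sub_ne_zero.2 (hC n).symm
  induction n with
  | zero => simp [qRatio_zero]
  | succ n ih =>
    set s : ℕ → ℂ := fun k => qRatio a q q k * qRatio b (a * b * l) q k * l ^ k with hs
    -- The Wilf–Zeilberger certificate of the first-order recurrence in `n`. Its value at
    -- `k = n + 1` supplies the top summand of the sum for `n + 1`.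
    set G : ℕ → ℂ := fun k => -((q ^ (n + 1 - k) - a * b * l * q ^ n) * (1 - q ^ k) *
      (s k * qRatio l q q (n + 1 - k))) with hG
    have hwz : ∀ k ∈ Finset.range (n + 1),
        (1 - q * q ^ n) * (1 - a * b * l * q ^ n) * (s k * qRatio l q q (n + 1 - k)) -
          (1 - a * l * q ^ n) * (1 - b * l * q ^ n) * (s k * qRatio l q q (n - k)) =
        G (k + 1) - G k := by
      intro k hk
      obtain ⟨j, rfl⟩ := Nat.exists_eq_add_of_le (Nat.lt_succ_iff.1 (Finset.mem_range.1 hk))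
      have h1 := hqn j
      have h2 := hqn k
      have h3 := hCn k
      simp only [hG, hs]
      rw [show k + j + 1 - k = j + 1 by omega, show k + j + 1 - (k + 1) = j by omega,
        show k + j - k = j by omega]
      simp only [qRatio_succ, pow_add, pow_one]
      generalize q ^ j = x at *
      generalize q ^ k = y at *
      -- the order of factors in which `field_simp` meets this denominator
      have h3' : 1 - y * a * b * l ≠ 0 := by convert h3 using 2; ring
      field_simp
      ring
    have hsum := Finset.sum_congr rfl hwz
    rw [Finset.sum_range_sub, Finset.sum_sub_distrib, ← Finset.mul_sum, ← Finset.mul_sum] at hsum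
    rw [Finset.sum_range_succ]
    rw [ih] at hsum
    have h2 := hqn n
    have h3 := hCn n
    have hG0 : G 0 = 0 := by simp [hG]
    have hG1 : G (n + 1) = -((1 - q * q ^ n) * (1 - a * b * l * q ^ n) *
        (s (n + 1) * qRatio l q q (n + 1 - (n + 1)))) := by
      simp only [hG, Nat.sub_self, pow_zero, pow_succ]
      ring
    rw [hG0, hG1] at hsum
    refine mul_left_cancel₀ (mul_ne_zero h2 h3) ?_
    rw [qRatio_succ (a * l), qRatio_succ (b * l)]
    have h4 : (1 - q * q ^ n) * (1 - a * b * l * q ^ n) * (qRatio (a * l) q q n *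
        ((1 - a * l * q ^ n) / (1 - q * q ^ n)) * (qRatio (b * l) (a * b * l) q n *
        ((1 - b * l * q ^ n) / (1 - a * b * l * q ^ n)))) =
        (1 - a * l * q ^ n) * (1 - b * l * q ^ n) *
          (qRatio (a * l) q q n * qRatio (b * l) (a * b * l) q n) := by
      generalize 1 - q * q ^ n = d at h2
      generalize 1 - a * b * l * q ^ n = e at h3
      field_simp
    rw [h4]
    linear_combination hsum

theorem qHypTerm_two_one (a b c q z : ℂ) (n : ℕ) :
    qHypTerm ![a, b] ![c] q z n = qRatio a q q n * qRatio b c q n * z ^ n := by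
  simp [qHypTerm, qRatio, mul_div_mul_comm]

theorem summable_norm_qHypTerm_two_one (a b : ℂ) {c q z : ℂ} (hq : ‖q‖ < 1) (hz : ‖z‖ < 1)
    (hc : ∀ m : ℕ, c * q ^ m ≠ 1) : Summable fun n => ‖qHypTerm ![a, b] ![c] q z n‖ := by
  obtain ⟨M, hM0, hM⟩ := exists_norm_qRatio_le a hq (mul_pow_ne_one hq hq)
  obtain ⟨N, hN0, hN⟩ := exists_norm_qRatio_le b hq hc
  refine Summable.of_nonneg_of_le (fun _ => norm_nonneg _) (fun n => ?_)
    ((summable_geometric_of_lt_one (norm_nonneg z) hz).mul_left (M * N))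
  rw [qHypTerm_two_one, norm_mul, norm_mul, norm_pow]
  exact mul_le_mul_of_nonneg_right (mul_le_mul (hM n) (hN n) (norm_nonneg _) hM0) (by positivity)

/-- The Euler transformation `₂φ₁(al, bl; abl; z) = (lz; q)_∞ / (z; q)_∞ · ₂φ₁(a, b; abl; lz)`.
It is a Cauchy product, so absolute convergence of the right-hand series suffices, be it because
`‖l * z‖ < 1` or because the series terminates. -/
theorem hasSum_qEuler {a b l q z L : ℂ} (hq : ‖q‖ < 1) (hz : ‖z‖ < 1)
    (hC : ∀ m : ℕ, a * b * l * q ^ m ≠ 1)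
    (hL : Tendsto (qRatio (l * z) z q) atTop (𝓝 L))
    (hs : Summable fun n => ‖qHypTerm ![a, b] ![a * b * l] q (l * z) n‖) :
    HasSum (qHypTerm ![a * l, b * l] ![a * b * l] q z)
      ((∑' n, qHypTerm ![a, b] ![a * b * l] q (l * z) n) * L) := by
  have hbin := hasSum_qBinomial hq hz hL
  have h := hasSum_sum_range_mul_of_summable_norm hs hbin.summable.norm
  rw [hbin.tsum_eq] at h
  rw [show qHypTerm ![a * l, b * l] ![a * b * l] q z = _ from funext fun n => ?_]
  · exact h
  rw [qHypTerm_two_one, ← qSaalschutz hq hC, Finset.sum_mul]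
  refine Finset.sum_congr rfl fun k hk => ?_
  rw [qHypTerm_two_one, ← Nat.add_sub_of_le (Nat.lt_succ_iff.1 (Finset.mem_range.1 hk)),
    Nat.add_sub_cancel_left, pow_add, mul_pow]
  ring

/-! ### The double series -/

/-- The quotient `(w q^(2n+1); q)_k / (w q^(2n); q)_k` collapses to a single factor, so the `₄φ₃`
term is a `₂φ₁` term times a bounded correction. -/
theorem qHypTerm_four_three {w z q : ℂ} (a b c : ℂ)
    (hw : ∀ m : ℕ, w * q ^ m ≠ 1) (n k : ℕ) :
    qHypTerm ![w * q ^ n, w * q ^ (2 * n + 1), a, b] ![c, z * q ^ n, w * q ^ (2 * n)] q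
      (w * q ^ n) k =
    qHypTerm ![a, b] ![c] q w k * (qRatio (w * q ^ n) (z * q ^ n) q k *
      ((1 - w * q ^ (2 * n) * q ^ k) / (1 - w * q ^ (2 * n))) * q ^ (n * k)) := by
  have hshift : ∀ i m, w * q ^ i * q ^ m ≠ 1 := fun i m => by
    rw [mul_assoc, ← pow_add]; exact hw _
  have h1 : 1 - w * q ^ (2 * n) ≠ 0 := sub_ne_zero.2 (hw _).symm
  have h2 : qPoch (w * q ^ (2 * n)) q k ≠ 0 := qPoch_ne_zero (hshift _) k
  have h3 : qPoch (w * q ^ (2 * n + 1)) q k / qPoch (w * q ^ (2 * n)) q k =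
      (1 - w * q ^ (2 * n) * q ^ k) / (1 - w * q ^ (2 * n)) := by
    rw [div_eq_div_iff h2 h1, pow_succ, ← mul_assoc, qPoch_mul_q, mul_comm]
  rw [← h3]
  simp only [qHypTerm, qRatio, Fin.prod_univ_succ, Fin.prod_univ_zero, Matrix.cons_val_zero,
    Matrix.cons_val_succ, mul_one, mul_pow, ← pow_mul]
  simp only [div_eq_mul_inv, mul_inv]
  ring

theorem summable_qHypTerm_four_three {a b c w z q : ℂ} (hq : ‖q‖ < 1) (hz : ‖z‖ < 1)
    (hw : ∀ m : ℕ, w * q ^ m ≠ 1) (hs : Summable fun k => ‖qHypTerm ![a, b] ![c] q w k‖) (n : ℕ) :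
    Summable (qHypTerm ![w * q ^ n, w * q ^ (2 * n + 1), a, b]
      ![c, z * q ^ n, w * q ^ (2 * n)] q (w * q ^ n)) := by
  obtain ⟨M, hM0, hM⟩ := exists_norm_qRatio_le (w * q ^ n) (b := z * q ^ n) hq fun m => by
    rw [mul_assoc, ← pow_add]; exact mul_pow_ne_one hz hq _
  refine (hs.mul_right (M * ((1 + ‖w * q ^ (2 * n)‖) / ‖1 - w * q ^ (2 * n)‖) * 1)).of_norm_bounded
    fun k => ?_
  rw [qHypTerm_four_three a b c hw, norm_mul, norm_mul, norm_mul, norm_div]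
  gcongr
  · exact hM k
  · exact norm_one_sub_mul_pow_le _ hq k
  · exact norm_pow_le_one hq _

/-- The `(n, k)` term of the double series is a coefficient independent of `n` times the `n`-th
term of the very-well-poised series with parameter `z * q ^ k`. -/
theorem coeff_mul_qHypTerm_four_three {l z q : ℂ} (a b c : ℂ)
    (hw : ∀ m : ℕ, l * z * q ^ m ≠ 1) (n k : ℕ) :
    (qPoch (l * q) q n * qPoch (l * z) q n) / (qPoch q q n * qPoch z q n) * z ^ n *
        q ^ (n * (n - 1)) * (1 - l * z * q ^ (2 * n)) *
      qHypTerm ![l * z * q ^ n, l * z * q ^ (2 * n + 1), a, b] ![c, z * q ^ n, l * z * q ^ (2 * n)]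
        q (l * z * q ^ n) k =
    qHypTerm ![a, b] ![c] q (l * z) k * (qRatio (l * q) q q n * qRatio (l * z) z q (n + k) *
      (1 - l * z * q ^ (2 * n + k)) * (z ^ n * q ^ (n * (n - 1) + n * k))) := by
  have h1 : 1 - l * z * q ^ (2 * n) ≠ 0 := sub_ne_zero.2 (hw _).symm
  have h2 : (qPoch (l * q) q n * qPoch (l * z) q n) / (qPoch q q n * qPoch z q n) =
      qRatio (l * q) q q n * qRatio (l * z) z q n := mul_div_mul_comm _ _ _ _
  rw [qHypTerm_four_three a b c hw, h2, qRatio_add, pow_add, pow_add, ← mul_assoc (l * z)]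
  field_simp

/-- Apart from the geometric factor `‖z‖ ^ n` and the `k`-th term of an absolutely convergent
`₂φ₁`, every factor of the double series is bounded. -/
theorem summable_double {a b c l z q : ℂ} (hq : ‖q‖ < 1) (hz : ‖z‖ < 1)
    (hs : Summable fun k => ‖qHypTerm ![a, b] ![c] q (l * z) k‖) :
    Summable fun p : ℕ × ℕ => qHypTerm ![a, b] ![c] q (l * z) p.2 *
      (qRatio (l * q) q q p.1 * qRatio (l * z) z q (p.1 + p.2) *
      (1 - l * z * q ^ (2 * p.1 + p.2)) * (z ^ p.1 * q ^ (p.1 * (p.1 - 1) + p.1 * p.2))) := by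
  obtain ⟨M, hM0, hM⟩ := exists_norm_qRatio_le (l * q) hq (mul_pow_ne_one hq hq)
  obtain ⟨N, hN0, hN⟩ := exists_norm_qRatio_le (l * z) hq (mul_pow_ne_one hz hq)
  have hgeo := summable_geometric_of_lt_one (norm_nonneg z) hz
  refine ((hgeo.mul_of_nonneg hs (fun _ => by positivity) fun _ => norm_nonneg _).mul_left
    (M * N * (1 + ‖l * z‖))).of_norm_bounded fun p => ?_
  calc _ = ‖qHypTerm ![a, b] ![c] q (l * z) p.2‖ * (‖qRatio (l * q) q q p.1‖ *
        ‖qRatio (l * z) z q (p.1 + p.2)‖ * ‖1 - l * z * q ^ (2 * p.1 + p.2)‖ *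
        (‖z‖ ^ p.1 * ‖q ^ (p.1 * (p.1 - 1) + p.1 * p.2)‖)) := by
          simp only [norm_mul, norm_pow]
    _ ≤ ‖qHypTerm ![a, b] ![c] q (l * z) p.2‖ * (M * N * (1 + ‖l * z‖) * (‖z‖ ^ p.1 * 1)) := by
          gcongr
          · exact hM _
          · exact hN _
          · exact norm_one_sub_mul_pow_le _ hq _
          · exact norm_pow_le_one hq _
    _ = _ := by ring

theorem summable_norm_qHypTerm_of_terminates {a b c q w : ℂ} {m : ℕ}
    (h : a * q ^ m = 1 ∨ b * q ^ m = 1) :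
    Summable fun k => ‖qHypTerm ![a, b] ![c] q w k‖ := by
  refine summable_of_ne_finset_zero (s := Finset.range (m + 1)) fun k hk => ?_
  have hk : m < k := by simpa using hk
  rw [qHypTerm_two_one, qRatio, qRatio]
  rcases h with h | h <;> simp [qPoch_eq_zero h hk]

theorem mainTheorem6 (q A B C z : ℂ) (hq : ‖q‖ < 1) (hz : ‖z‖ < 1)
    (hA : A ≠ 0) (hB : B ≠ 0) (hC : C ≠ 0)
    -- the denominators do not vanish
    (hCq : ∀ m : ℕ, C * q ^ m ≠ 1) (hw : ∀ m : ℕ, A * B * z / C * q ^ m ≠ 1)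
    -- the inner series converge: small argument, or `C / A` or `C / B` is some `q ^ (-m)`
    (hconv : ‖A * B * z / C‖ < 1 ∨ ∃ m : ℕ, C / A * q ^ m = 1 ∨ C / B * q ^ m = 1) :
    Summable (qHypTerm ![A, B] ![C] q z) ∧
    (∀ n : ℕ, Summable (qHypTerm
      ![A * B * z * q ^ n / C, A * B * z * q ^ (2 * n + 1) / C, C / A, C / B]
      ![C, z * q ^ n, A * B * z * q ^ (2 * n) / C] q (A * B * z * q ^ n / C))) ∧
    HasSum (fun n : ℕ =>
      (qPoch (A * B * q / C) q n * qPoch (A * B * z / C) q n) / (qPoch q q n * qPoch z q n)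
        * z ^ n * q ^ (n * (n - 1)) * (1 - A * B * z * q ^ (2 * n) / C)
        * qHyp
            ![A * B * z * q ^ n / C, A * B * z * q ^ (2 * n + 1) / C, C / A, C / B]
            ![C, z * q ^ n, A * B * z * q ^ (2 * n) / C] q (A * B * z * q ^ n / C))
      (qHyp ![A, B] ![C] q z) := by
  -- `l` is kept opaque so that the parameters `l * z`, `l * q` survive simplification
  obtain ⟨l, hl⟩ : ∃ l, l = A * B / C := ⟨_, rfl⟩
  have hlz : A * B * z / C = l * z := by rw [hl]; ring
  have hlq : A * B * q / C = l * q := by rw [hl]; ring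
  have hlp : ∀ i : ℕ, A * B * z * q ^ i / C = l * z * q ^ i := fun i => by rw [hl]; ring
  simp only [hlz] at hw hconv
  simp only [hlz, hlq, hlp]
  have hs : Summable fun k => ‖qHypTerm ![C / A, C / B] ![C] q (l * z) k‖ := by
    rcases hconv with h | ⟨m, h⟩
    · exact summable_norm_qHypTerm_two_one _ _ hq h hCq
    · exact summable_norm_qHypTerm_of_terminates h
  obtain ⟨L, hL⟩ := exists_tendsto_qRatio (l * z) hq (mul_pow_ne_one hz hq)
  have hsum := summable_qHypTerm_four_three (z := z) hq hz hw hs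
  have hEuler : HasSum (qHypTerm ![A, B] ![C] q z)
      ((∑' n, qHypTerm ![C / A, C / B] ![C] q (l * z) n) * L) := by
    have e1 : C / A * (C / B) * l = C := by rw [hl]; field_simp
    have e2 : C / A * l = B := by rw [hl]; field_simp
    have e3 : C / B * l = A := by rw [hl]; field_simp
    have h := hasSum_qEuler (a := C / B) (b := C / A) (l := l) hq hz
      (by rwa [mul_comm (C / B), e1]) hL
    rw [mul_comm (C / B) (C / A), e1, e2, e3] at h
    have e4 : ∀ k, qHypTerm ![C / B, C / A] ![C] q (l * z) k =
        qHypTerm ![C / A, C / B] ![C] q (l * z) k := fun k => by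
      simp [qHypTerm, mul_comm]
    simp only [e4] at h
    exact h hs
  refine ⟨hEuler.summable, hsum, ?_⟩
  rw [qHyp, hEuler.tsum_eq]
  have hdouble := summable_double hq hz hs
  -- summing over `n` first evaluates every column by the very-well-poised sum
  have htotal := (hdouble.prod_symm.hasSum.prod_fiberwise fun k =>
    (hasSum_veryWellPoised hq hz hL k).mul_left (qHypTerm ![C / A, C / B] ![C] q (l * z) k)).unique
      (hs.of_norm.hasSum.mul_right L)
  have hswap := (Equiv.prodComm ℕ ℕ).tsum_eq fun p : ℕ × ℕ =>
    qHypTerm ![C / A, C / B] ![C] q (l * z) p.2 *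
      (qRatio (l * q) q q p.1 * qRatio (l * z) z q (p.1 + p.2) *
      (1 - l * z * q ^ (2 * p.1 + p.2)) * (z ^ p.1 * q ^ (p.1 * (p.1 - 1) + p.1 * p.2)))
  rw [← htotal]
  -- summing over `k` first gives the rows of the statement
  refine (hswap ▸ hdouble.hasSum).prod_fiberwise fun n => ?_
  have hrow := (hsum n).hasSum.mul_left
    ((qPoch (l * q) q n * qPoch (l * z) q n) / (qPoch q q n * qPoch z q n) * z ^ n *
      q ^ (n * (n - 1)) * (1 - l * z * q ^ (2 * n)))
  simp only [coeff_mul_qHypTerm_four_three _ _ _ hw] at hrow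
  exact hrow
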